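/- Let $q$ be an odd prime power, let $m\ge 2$ be an even integer, and put $n=q^m+1$. Let $\beta$ be a primitive $n$-th root of unity in an extension field of $\mathbb F_q$, and for $i\ge 1$ let $m_i(x)$ be the minimal polynomial of $\beta^i$ over $\mathbb F_q$. For an integer $\delta$ let $\mathcal C_\delta$ be the narrow-sense BCH code of length $n$ and designed distance $\delta$ over $\mathbb F_q$, i.e. the cyclic code (the ideal of $\mathbb F_q[x]/\langle x^n-1\rangle$, read as a subspace of $\mathbb F_q^n$) generated by $\operatorname{lcm}(m_1(x),\dots,m_{\delta-1}(x))$, and let $\mathcal C_\delta^{\perp}\subseteq\mathbb F_q^n$ be its Euclidean dual. Let $A=\begin{pmatrix}a_{11}&a_{12}\\a_{21}&a_{22}\end{pmatrix}$ be a nonsingular matrix over $\mathbb F_q$; if $m=2$, assume in addition that $a_{11}\neq0$ and $a_{12}\neq 0$. Let $$\mathcal C'_\delta=[\mathcal C_\delta^{\perp},\mathcal C_\delta]A=\{(a_{11}u+a_{21}v,\;a_{12}u+a_{22}v): u\in \mathcal C_\delta^{\perp},\ v\in\mathcal C_\delta\}\subseteq \mathbb F_q^{2n}$$ be the matrix-product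 code. If $2\le l\le \frac{q-3}{2}$ and $$l q^{m/2}+\frac{q^{m/2}+3}{2}\le \delta<(l+1)q^{m/2}+\frac{q^{m/2}+3}{2},$$ then the minimum Hamming distance of $\mathcal C'_\delta$ satisfies $$d(\mathcal C'_\delta)\ge 2q^{m/2}-4l-2 .$$ If moreover $m\ge 4$, then $2q^{m/2}-4l-2>\sqrt{2n}$, so the bound is better than the square-root lower bound for the length $2n$. -/

import Mathlib

open Polynomial

/-- The minimum Hamming distance of a linear code `C`, that is, the least Hamming weight of a
nonzero codeword (with the value `0` for the zero code). -/
noncomputable def minDist {F ι : Type*} [Field F] [Fintype ι] (C : Submodule F (ι → F)) : ℕ := by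
  classical
  exact sInf {w : ℕ | ∃ c ∈ C, c ≠ 0 ∧ hammingNorm c = w}

/-- The Euclidean dual of a linear code. -/
def euclideanDual {F ι : Type*} [Field F] [Fintype ι] (C : Submodule F (ι → F)) :
    Submodule F (ι → F) where
  carrier := {x | ∀ c ∈ C, ∑ i, x i * c i = 0}
  zero_mem' := by intro c _; simp
  add_mem' := by
    intro x y hx hy c hc
    simp only [Pi.add_apply, add_mul, Finset.sum_add_distrib, hx c hc, hy c hc, add_zero]
  smul_mem' := by
    intro a x hx c hc
    simp only [Pi.smul_apply, smul_eq_mul, mul_assoc, ← Finset.mul_sum, hx c hc, mul_zero]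

/-- The linear map sending `(c_0, …, c_{n-1})` to the polynomial `∑ c_i x^i`. -/
noncomputable def vecToPoly (F : Type*) [Field F] (n : ℕ) : (Fin n → F) →ₗ[F] F[X] :=
  ∑ i : Fin n, (Polynomial.monomial (i : ℕ)) ∘ₗ (LinearMap.proj i : (Fin n → F) →ₗ[F] F)

/-- The ideal generated by `x^n - 1`. -/
noncomputable def cyclicModulus (F : Type*) [Field F] (n : ℕ) : Ideal F[X] :=
  Ideal.span {(X ^ n - 1 : F[X])}

/-- The cyclic code of length `n` generated by `g`: the vectors `(c_0, …, c_{n-1})` for which the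
class of `∑ c_i x^i` lies in the ideal `⟨g⟩` of `F[x]/⟨x^n - 1⟩`. -/
noncomputable def cyclicCode {F : Type*} [Field F] (n : ℕ) (g : F[X]) :
    Submodule F (Fin n → F) :=
  ((Ideal.span {Ideal.Quotient.mk (cyclicModulus F n) g}).restrictScalars F).comap
    ((Ideal.Quotient.mkₐ F (cyclicModulus F n)).toLinearMap ∘ₗ vecToPoly F n)

open Classical in
/-- The monic polynomial `lcm (m_b(x), m_{b+1}(x), …, m_{b+δ-2}(x))`, where `m_i(x)` is the minimal
polynomial of `β^i` over `F`. -/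
noncomputable def bchGenerator (F : Type*) {K : Type*} [Field F] [Field K] [Algebra F K]
    (β : K) (δ b : ℕ) : F[X] :=
  letI : NormalizedGCDMonoid F[X] :=
    UniqueFactorizationMonoid.toNormalizedGCDMonoid F[X]
  (Finset.range (δ - 1)).lcm fun i => minpoly F (β ^ (b + i))

/-- The narrow-sense BCH code over `F` of length `n` and designed distance `δ`, with respect to the
primitive `n`-th root of unity `β` in an extension field of `F`. -/
noncomputable def bchCode (F : Type*) {K : Type*} [Field F] [Field K] [Algebra F K]
    (n : ℕ) (β : K) (δ : ℕ) : Submodule F (Fin n → F) :=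
  cyclicCode n (bchGenerator F β δ 1)

/-- The linear map sending `(c_1, …, c_s)` to the concatenation, for `j = 1, …, t`, of the blocks
`∑ i, a_{ij} c_i`; the coordinate `k` of block `j` has the index `(j, k)`. -/
def matrixProductMap {F ι : Type*} [Field F] {s t : ℕ} (A : Matrix (Fin s) (Fin t) F) :
    (Fin s → ι → F) →ₗ[F] (Fin t × ι → F) where
  toFun c := fun p => ∑ i, A i p.1 * c i p.2
  map_add' x y := by
    funext p
    simp [mul_add, Finset.sum_add_distrib]
  map_smul' a x := by
    funext p
    simp [Finset.mul_sum, mul_left_comm]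

/-- The matrix-product code `[C_1, …, C_s] A`. -/
def matrixProductCode {F ι : Type*} [Field F] {s t : ℕ} (C : Fin s → Submodule F (ι → F))
    (A : Matrix (Fin s) (Fin t) F) : Submodule F (Fin t × ι → F) :=
  (Submodule.pi Set.univ C).map (matrixProductMap A)

/-! Put `h = m / 2`, `Q = q ^ h`, `n = Q ^ 2 + 1 = 2 * N`. A word with `v ≠ 0` has weight at least
`wt v ≥ δ ≥ 2 * Q`, by nonsingularity of `A` and the BCH bound. For `v = 0` the weight is `wt (a₁₁
u) + wt (a₁₂ u)`, so everything rests on the dual code.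

A dual word vanishes at `β ^ (N + κ)` as soon as every `q ^ j * κ` has a representative `v` modulo
`n` with `|v| ≤ N - δ`. If `h = 1`, this gives a run of `q - 2 * l - 2` consecutive zeros centred at
`N`; the BCH bound is then doubled because both entries of the first row are nonzero.

If `h ≥ 2`, the zeros include `κ = a + Q * b` for all good `a`, `b` (`IsGood.exists_abs_le`). For a
word of weight `w < 2 * Q - 4 * l - 2`, a centred interval of length `w` has more than `w / 2` good
elements (`lt_two_mul_card_filter_isGood`). Taking both `A` and `B` to be this set contradicts `|A|
+ |B| ≤ w` (`card_add_card_le_hammingNorm`). -/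

section Cyclic

/-! ### Zeros of BCH codes and of their duals. -/

variable {F K : Type*} [Field F] [Field K] [Algebra F K]

theorem aeval_vecToPoly (n : ℕ) (c : Fin n → F) (z : K) :
    aeval z (vecToPoly F n c) = ∑ t, algebraMap F K (c t) * z ^ (t : ℕ) := by
  simp [vecToPoly, aeval_monomial]

theorem mem_cyclicCode_iff {n : ℕ} {g : F[X]} {c : Fin n → F} :
    c ∈ cyclicCode n g ↔ ∃ u v : F[X], vecToPoly F n c = g * u + (X ^ n - 1) * v := by
  simp only [cyclicCode, Submodule.mem_comap, Submodule.restrictScalars_mem, LinearMap.comp_apply,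
    AlgHom.toLinearMap_apply, Ideal.Quotient.mkₐ_eq_mk, Ideal.mem_span_singleton]
  constructor
  · rintro ⟨w, hw⟩
    obtain ⟨u, rfl⟩ := Ideal.Quotient.mk_surjective w
    rw [← map_mul, Ideal.Quotient.mk_eq_mk_iff_sub_mem, cyclicModulus,
      Ideal.mem_span_singleton] at hw
    obtain ⟨v, hv⟩ := hw
    exact ⟨u, v, by rw [← hv]; ring⟩
  · rintro ⟨u, v, h⟩
    refine ⟨Ideal.Quotient.mk _ u, ?_⟩
    rw [← map_mul, Ideal.Quotient.mk_eq_mk_iff_sub_mem, cyclicModulus, Ideal.mem_span_singleton]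
    exact ⟨v, by rw [h]; ring⟩

theorem minpoly_dvd_bchGenerator (β : K) {δ b i : ℕ} (hi : i < δ - 1) :
    minpoly F (β ^ (b + i)) ∣ bchGenerator F β δ b := by
  classical
  let _ : NormalizedGCDMonoid F[X] := UniqueFactorizationMonoid.toNormalizedGCDMonoid F[X]
  exact Finset.dvd_lcm (f := fun i => minpoly F (β ^ (b + i))) (Finset.mem_range.2 hi)

theorem bchGenerator_dvd (β : K) {δ b : ℕ} {f : F[X]}
    (h : ∀ i < δ - 1, minpoly F (β ^ (b + i)) ∣ f) : bchGenerator F β δ b ∣ f := by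
  classical
  let _ : NormalizedGCDMonoid F[X] := UniqueFactorizationMonoid.toNormalizedGCDMonoid F[X]
  exact Finset.lcm_dvd fun i hi => h i (Finset.mem_range.1 hi)

theorem mem_bchCode_iff {n : ℕ} {β : K} (hβ : β ^ n = 1) {δ : ℕ} {c : Fin n → F} :
    c ∈ bchCode F n β δ ↔
      ∀ i, 1 ≤ i → i < δ → ∑ t, algebraMap F K (c t) * (β ^ i) ^ (t : ℕ) = 0 := by
  simp only [← aeval_vecToPoly, bchCode, mem_cyclicCode_iff]
  constructor
  · rintro ⟨u, v, h⟩ i hi hiδ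
    obtain ⟨w, hw⟩ := minpoly_dvd_bchGenerator (F := F) β (b := 1) (δ := δ) (i := i - 1) (by omega)
    rw [Nat.add_sub_cancel' hi] at hw
    have hn : (β ^ i) ^ n = 1 := by rw [← pow_mul, mul_comm, pow_mul, hβ, one_pow]
    simp [h, hw, hn]
  · intro h
    obtain ⟨u, hu⟩ : bchGenerator F β δ 1 ∣ vecToPoly F n c :=
      bchGenerator_dvd β fun i hi => minpoly.dvd _ _ (h _ (by omega) (by omega))
    exact ⟨u, 0, by rw [hu]; ring⟩

/-- The roots of the minimal polynomial over a finite field are the iterates of the Frobenius. -/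
theorem exists_eq_pow_card_pow_of_aeval_minpoly [Fintype F] {y z : K} (hy : IsIntegral F y)
    (hz : aeval z (minpoly F y) = 0) : ∃ j : ℕ, z = y ^ Fintype.card F ^ j := by
  have hmz : minpoly F z = minpoly F y :=
    (minpoly.eq_of_irreducible_of_monic (minpoly.irreducible hy) hz (minpoly.monic hy)).symm
  have hzi : IsIntegral F z := ⟨_, minpoly.monic hy, hz⟩
  let E := IntermediateField.adjoin F {y, z}
  have hfin : FiniteDimensional F E := by
    refine IntermediateField.finiteDimensional_adjoin ?_
    rintro x (rfl | rfl)
    exacts [hy, hzi]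
  have : Finite E := Module.finite_of_finite F
  let y' : E := ⟨y, IntermediateField.subset_adjoin F _ (by simp)⟩
  let z' : E := ⟨z, IntermediateField.subset_adjoin F _ (by simp)⟩
  have hconj : IsConjRoot F z' y' := by
    rw [isConjRoot_def, ← minpoly.algebraMap_eq (algebraMap E K).injective z',
      ← minpoly.algebraMap_eq (algebraMap E K).injective y']
    exact hmz
  obtain ⟨σ, hσ⟩ := (isConjRoot_iff_exists_algEquiv).1 hconj
  obtain ⟨j, rfl⟩ := (FiniteField.bijective_frobeniusAlgEquivOfAlgebraic_pow F E).2 σ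
  refine ⟨j, ?_⟩
  simp only [AlgEquiv.coe_pow, FiniteField.coe_frobeniusAlgEquivOfAlgebraic_iterate] at hσ
  exact congrArg (algebraMap E K) hσ.symm

/-- With `L u = ∑ φ (y ^ t * u) * z ^ t`, a cyclic shift gives `L (y * u) = z⁻¹ * L u`, hence `L
(f(y) * u) = f(z⁻¹) * L u` for every polynomial `f` over `F`. The minimal polynomial of `y` kills
the left side but not the factor on the right. -/
theorem sum_dual_mul_pow_eq_zero {n : ℕ} {y z : K} (hy : y ^ n = 1) (hz : z ^ n = 1)
    (hz0 : z ≠ 0) (hne : aeval z⁻¹ (minpoly F y) ≠ 0) (φ : K →ₗ[F] F) :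
    ∑ t : Fin n, algebraMap F K (φ (y ^ (t : ℕ))) * z ^ (t : ℕ) = 0 := by
  let L : K →ₗ[F] K := ∑ t ∈ Finset.range n,
    (LinearMap.mulRight F (z ^ t)) ∘ₗ (Algebra.linearMap F K) ∘ₗ φ ∘ₗ (LinearMap.mulLeft F (y ^ t))
  have hL : ∀ u, L u = ∑ t ∈ Finset.range n, algebraMap F K (φ (y ^ t * u)) * z ^ t := fun u => by
    simp [L]
  have hshift : ∀ u, L (y * u) = z⁻¹ * L u := by
    intro u
    rw [eq_inv_mul_iff_mul_eq₀ hz0, hL, hL, Finset.mul_sum]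
    have h := Finset.sum_range_succ' (fun t => algebraMap F K (φ (y ^ t * u)) * z ^ t) n
    rw [Finset.sum_range_succ] at h
    simp only [hy, hz, pow_zero] at h
    rw [add_right_cancel h]
    refine Finset.sum_congr rfl fun t _ => ?_
    rw [pow_succ y, pow_succ z, mul_assoc (y ^ t)]
    ring
  have hpoly : ∀ f : F[X], ∀ u, L (aeval y f * u) = aeval z⁻¹ f * L u := by
    intro f
    induction f using Polynomial.induction_on' with
    | add f g hf hg => intro u; simp only [map_add, add_mul, hf, hg]
    | monomial k a =>
      induction k with
      | zero => intro u; simp [← Algebra.smul_def]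
      | succ k ih =>
        intro u
        have e : ∀ w : K, aeval w (monomial (k + 1) a) = aeval w (monomial k a) * w := fun w => by
          simp only [aeval_monomial]; ring
        rw [e, e, mul_assoc, ih, hshift, mul_assoc]
  have h1 := hpoly (minpoly F y) 1
  rw [minpoly.aeval, zero_mul, map_zero, eq_comm, mul_eq_zero, or_iff_right hne, hL] at h1
  rw [Fin.sum_univ_eq_sum_range fun t => algebraMap F K (φ (y ^ t)) * z ^ t]
  simpa using h1

/-- Each word `t ↦ φ (y ^ t)` lies in the BCH code, so `φ` vanishes at `∑ x t * y ^ t` for every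
linear functional `φ`. -/
theorem sum_eq_zero_of_mem_euclideanDual_bchCode [Fintype F] {n : ℕ} (hn : 0 < n) {β y : K}
    {δ : ℕ} (hβ : β ^ n = 1) (hy : y ^ n = 1)
    (h : ∀ i, 1 ≤ i → i < δ → ∀ j, β ^ i * y ^ Fintype.card F ^ j ≠ 1)
    {x : Fin n → F} (hx : x ∈ euclideanDual (bchCode F n β δ)) :
    ∑ t, algebraMap F K (x t) * y ^ (t : ℕ) = 0 := by
  have hint : IsIntegral F y := ⟨X ^ n - 1, monic_X_pow_sub_C 1 hn.ne', by simp [hy]⟩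
  rw [← Module.forall_dual_apply_eq_zero_iff F]
  intro φ
  have hmem : (fun t : Fin n => φ (y ^ (t : ℕ))) ∈ bchCode F n β δ := by
    rw [mem_bchCode_iff hβ]
    intro i hi hiδ
    have hz : (β ^ i) ^ n = 1 := by rw [← pow_mul, mul_comm, pow_mul, hβ, one_pow]
    have hz0 : β ^ i ≠ 0 := fun h0 => by simp [h0, hn.ne'] at hz
    refine sum_dual_mul_pow_eq_zero hy hz hz0 (fun h0 => ?_) φ
    obtain ⟨j, hj⟩ := exists_eq_pow_card_pow_of_aeval_minpoly hint h0
    exact h i hi hiδ j (by rw [← hj, mul_inv_cancel₀ hz0])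
  have := hx _ hmem
  simpa [← Algebra.smul_def] using this

end Cyclic

/-! ### A bound on the weight from two sets of exponents. -/

section RootBound

variable {K : Type*} [Field K]

/-- After division by `x t ^ a₀`, a linear relation is a polynomial of degree below the number of
its distinct roots. -/
theorem linearIndependent_zpow {ι : Type*} [Fintype ι] {x : ι → K} (hx : Function.Injective x)
    (hx0 : ∀ t, x t ≠ 0) {a₀ : ℤ} {A : Finset ℤ} (hA : A ⊆ Finset.Ico a₀ (a₀ + Fintype.card ι)) :
    LinearIndependent K (fun (a : A) (t : ι) => x t ^ (a : ℤ)) := by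
  rw [Fintype.linearIndependent_iff]
  intro g hg a
  have hmem : ∀ a : A, a₀ ≤ a ∧ (a : ℤ) < a₀ + Fintype.card ι := fun a =>
    Finset.mem_Ico.1 (hA a.2)
  let f : K[X] := ∑ a : A, monomial ((a : ℤ) - a₀).toNat (g a)
  have hdeg : f.natDegree < Fintype.card ι ∨ f = 0 := by
    have h1 : f.degree < Fintype.card ι := by
      refine (degree_sum_le _ _).trans_lt ?_
      rw [Finset.sup_lt_iff (by exact WithBot.bot_lt_coe _)]
      intro a _
      refine (degree_monomial_le _ _).trans_lt ?_
      have := hmem a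
      exact_mod_cast (by omega : ((a : ℤ) - a₀).toNat < Fintype.card ι)
    by_cases h0 : f = 0
    · exact Or.inr h0
    · exact Or.inl ((natDegree_lt_iff_degree_lt h0).2 h1)
  have hf : f = 0 := by
    rcases hdeg with hdeg | h0
    · refine eq_zero_of_natDegree_lt_card_of_eval_eq_zero f hx (fun t => ?_) hdeg
      have h := congrFun hg t
      simp only [Finset.sum_apply, Pi.smul_apply, smul_eq_mul, Pi.zero_apply] at h
      have hpow : ∀ a : A, x t ^ (a : ℤ) = x t ^ a₀ * x t ^ ((a : ℤ) - a₀).toNat := by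
        intro a
        rw [← zpow_natCast, Int.toNat_of_nonneg (by have := hmem a; omega), ← zpow_add₀ (hx0 t)]
        congr 1
        ring
      simp only [f, eval_finsetSum, eval_monomial]
      have h2 : x t ^ a₀ * ∑ a : A, g a * x t ^ ((a : ℤ) - a₀).toNat = 0 := by
        rw [← h, Finset.mul_sum]
        exact Finset.sum_congr rfl fun a _ => by rw [hpow]; ring
      exact (mul_eq_zero.1 h2).resolve_left (zpow_ne_zero _ (hx0 t))
    · exact h0
  have hc := congrArg (fun f => coeff f ((a : ℤ) - a₀).toNat) hf
  simp only [f, finsetSum_coeff, coeff_monomial, coeff_zero] at hc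
  rw [Finset.sum_eq_single a] at hc
  · simpa using hc
  · intro b _ hb
    rw [if_neg]
    intro h
    have h1 := hmem a
    have h2 := hmem b
    exact hb (Subtype.ext (by omega))
  · simp

theorem card_add_card_le_of_dotProduct_eq_zero {ι κ μ : Type*} [Fintype ι] [Fintype κ] [Fintype μ]
    {u : κ → ι → K} {v : μ → ι → K} (hu : LinearIndependent K u) (hv : LinearIndependent K v)
    (h : ∀ i j, ∑ t, u i t * v j t = 0) :
    Fintype.card κ + Fintype.card μ ≤ Fintype.card ι := by
  classical
  let M : Matrix μ ι K := Matrix.of v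
  have hrank : M.rank = Fintype.card μ := LinearIndependent.rank_matrix hv
  have hker := M.mulVecLin.finrank_range_add_finrank_ker
  rw [← Matrix.rank, hrank, Module.finrank_fintype_fun_eq_card] at hker
  have hmem : ∀ i, u i ∈ LinearMap.ker M.mulVecLin := by
    intro i
    rw [LinearMap.mem_ker]
    ext j
    simpa [M, Matrix.mulVec, dotProduct, mul_comm] using h i j
  have hli : LinearIndependent K (fun i => (⟨u i, hmem i⟩ : LinearMap.ker M.mulVecLin)) :=
    LinearIndependent.of_comp (LinearMap.ker M.mulVecLin).subtype hu
  have := hli.fintype_card_le_finrank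
  omega

/-- If the spectrum of `c` vanishes on `k + A + s B`, where `A` and `B` lie in intervals whose
length is the weight of `c`, then `|A| + |B|` is at most this weight. -/
theorem card_add_card_le_hammingNorm {n : ℕ} {β : K} (hβ : IsPrimitiveRoot β n) [DecidableEq K]
    {c : Fin n → K} {s : ℤ} (hs : IsCoprime s n) {k a₀ b₀ : ℤ} {A B : Finset ℤ}
    (hA : A ⊆ Finset.Ico a₀ (a₀ + hammingNorm c)) (hB : B ⊆ Finset.Ico b₀ (b₀ + hammingNorm c))
    (h : ∀ a ∈ A, ∀ b ∈ B, ∑ t, c t * (β ^ (k + a + s * b)) ^ (t : ℕ) = 0) :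
    A.card + B.card ≤ hammingNorm c := by
  rcases Nat.eq_zero_or_pos n with rfl | hn
  · simp [hammingNorm] at hA hB ⊢
    simp [hA, hB]
  have hβ0 : β ≠ 0 := hβ.ne_zero hn.ne'
  let ι := {t : Fin n // c t ≠ 0}
  have hcard : Fintype.card ι = hammingNorm c := by
    rw [Fintype.card_subtype]; rfl
  -- Coprimality keeps the nodes `β ^ (r * t)` distinct, which the Vandermonde argument needs for
  -- both `r = 1` and `r = s`.
  have hinj : ∀ r : ℤ, IsCoprime r n →
      Function.Injective (fun t : ι => (β ^ r) ^ ((t : Fin n) : ℕ)) := by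
    intro r hr t t' htt
    have htt' : (β ^ r) ^ ((t : Fin n) : ℕ) = (β ^ r) ^ ((t' : Fin n) : ℕ) := htt
    rw [← zpow_natCast, ← zpow_natCast, ← zpow_mul, ← zpow_mul] at htt'
    have h1 : β ^ (r * ((t : Fin n) : ℕ) - r * ((t' : Fin n) : ℕ)) = 1 := by
      rw [zpow_sub₀ hβ0, htt', div_self (zpow_ne_zero _ hβ0)]
    rw [hβ.zpow_eq_one_iff_dvd, ← mul_sub] at h1
    have h2 := (hr.symm.dvd_of_dvd_mul_left h1)
    have h3 := Int.eq_zero_of_abs_lt_dvd h2 (by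
      have := (t : Fin n).2
      have := (t' : Fin n).2
      rw [abs_lt]; constructor <;> omega)
    exact Subtype.ext (Fin.ext (by omega))
  rw [← hcard] at hA hB ⊢
  have hu := linearIndependent_zpow (hinj 1 isCoprime_one_left)
    (fun t => pow_ne_zero _ (zpow_ne_zero _ hβ0)) hA
  have hv := linearIndependent_zpow (hinj s hs)
    (fun t => pow_ne_zero _ (zpow_ne_zero _ hβ0)) hB
  -- On the support the factor `c t * β ^ (k * t)` is nonzero, so it can be absorbed into the second
  -- family; the hypothesis becomes orthogonality of the two families.
  let w : ι → Kˣ := fun t =>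
    Units.mk0 (c t * (β ^ k) ^ ((t : Fin n) : ℕ)) (mul_ne_zero t.2 (pow_ne_zero _ (zpow_ne_zero _ hβ0)))
  have hv' : LinearIndependent K (fun (b : B) (t : ι) =>
      (w t : K) * ((β ^ s) ^ ((t : Fin n) : ℕ)) ^ (b : ℤ)) := by
    rw [Fintype.linearIndependent_iff] at hv ⊢
    intro g hg
    refine hv g (funext fun t => ?_)
    have := congrFun hg t
    simp only [Finset.sum_apply, Pi.smul_apply, smul_eq_mul, Pi.zero_apply] at this ⊢
    refine (mul_eq_zero.1 (?_ : (w t : K) * _ = 0)).resolve_left (w t).ne_zero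
    rw [Finset.mul_sum]
    exact (Finset.sum_congr rfl fun b _ => by ring).trans this
  have key := card_add_card_le_of_dotProduct_eq_zero hu hv' ?_
  · simpa using key
  · intro a b
    have h1 := h a a.2 b b.2
    rw [← Finset.sum_filter_add_sum_filter_not _ (fun t => c t ≠ 0)] at h1
    have h2 : ∑ t with ¬ c t ≠ 0, c t * (β ^ (k + a + s * b)) ^ (t : ℕ) = 0 :=
      Finset.sum_eq_zero fun t ht => by
        simp only [Finset.mem_filter, not_not] at ht
        simp [ht.2]
    rw [h2, add_zero, Finset.sum_subtype (p := fun t => c t ≠ 0) _ (by simp)] at h1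
    refine (Finset.sum_congr rfl fun t _ => ?_).trans h1
    have e : (β ^ (k + a + s * b)) ^ ((t : Fin n) : ℕ) = (β ^ k) ^ ((t : Fin n) : ℕ) *
        (((β ^ (1 : ℤ)) ^ ((t : Fin n) : ℕ)) ^ (a : ℤ) *
          ((β ^ s) ^ ((t : Fin n) : ℕ)) ^ (b : ℤ)) := by
      simp only [← zpow_natCast, ← zpow_mul, ← zpow_add₀ hβ0]
      congr 1
      ring
    rw [e]
    simp only [w, Units.val_mk0]
    ring

end RootBound

/-! ### Exponents at which dual codewords vanish. -/

section Spectrum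

/-- Since `Q ^ 2 ≡ -1`, multiplication by `Q = q ^ h` turns `a + Q * b` into `-b + Q * a`; thus `h`
Frobenius steps preserve `G` and only `j < h` needs checking. -/
theorem exists_abs_le_of_orbit {q h δ : ℕ} (hh : 0 < h) {G : ℤ → ℤ → Prop}
    (hG : ∀ a b, G a b → G (-b) a)
    (hbound : ∀ a b, G a b → ∀ j < h, ∃ v : ℤ, ((q : ℤ) ^ h) ^ 2 + 1 ∣
      (q : ℤ) ^ j * (a + (q : ℤ) ^ h * b) - v ∧ 2 * |v| + 2 * δ ≤ ((q : ℤ) ^ h) ^ 2 + 1)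
    {a b : ℤ} (hab : G a b) (J : ℕ) : ∃ v : ℤ, ((q : ℤ) ^ h) ^ 2 + 1 ∣
      (q : ℤ) ^ J * (a + (q : ℤ) ^ h * b) - v ∧ 2 * |v| + 2 * δ ≤ ((q : ℤ) ^ h) ^ 2 + 1 := by
  induction J using Nat.strong_induction_on generalizing a b with
  | _ J ih =>
    by_cases hJ : J < h
    · exact hbound a b hab J hJ
    · obtain ⟨v, hv, hv'⟩ := ih (J - h) (by omega) (hG a b hab)
      refine ⟨v, ?_, hv'⟩
      have e : (q : ℤ) ^ J = (q : ℤ) ^ (J - h) * (q : ℤ) ^ h := by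
        rw [← pow_add]; congr 1; omega
      have : (q : ℤ) ^ J * (a + (q : ℤ) ^ h * b) - v =
          ((q : ℤ) ^ (J - h) * (-b + (q : ℤ) ^ h * a) - v) +
            (((q : ℤ) ^ h) ^ 2 + 1) * ((q : ℤ) ^ (J - h) * b) := by
        rw [e]; ring
      rw [this]
      exact dvd_add hv (Dvd.intro _ rfl)

theorem sum_eq_zero_of_abs_le {F K : Type*} [Field F] [Field K] [Algebra F K] [Fintype F]
    {N δ : ℕ} (hN : 0 < N) {β : K} (hβ : IsPrimitiveRoot β (2 * N))
    (hodd : Odd (Fintype.card F)) {κ : ℤ}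
    (h : ∀ j : ℕ, ∃ v : ℤ, ((2 * N : ℕ) : ℤ) ∣ (Fintype.card F : ℤ) ^ j * κ - v ∧
      2 * |v| + 2 * δ ≤ (2 * N : ℕ))
    {x : Fin (2 * N) → F} (hx : x ∈ euclideanDual (bchCode F (2 * N) β δ)) :
    ∑ t, algebraMap F K (x t) * (β ^ (N + κ)) ^ (t : ℕ) = 0 := by
  have hβ0 : β ≠ 0 := hβ.ne_zero (by omega)
  refine sum_eq_zero_of_mem_euclideanDual_bchCode (by omega) hβ.pow_eq_one ?_ ?_ hx
  · rw [← zpow_natCast, ← zpow_mul, mul_comm, zpow_mul, zpow_natCast, hβ.pow_eq_one, one_zpow]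
  · intro i hi hiδ j hij
    obtain ⟨v, hv, hvδ⟩ := h j
    rw [← zpow_natCast, ← zpow_natCast, ← zpow_mul, ← zpow_add₀ hβ0,
      hβ.zpow_eq_one_iff_dvd] at hij
    obtain ⟨r, hr⟩ := hodd.pow (n := j)
    -- As `q ^ j` is odd, `N` is fixed modulo `2 * N`. But `1 ≤ i ≤ δ - 1` and `|v| ≤ N - δ` put `i
    -- + N + v` strictly between `0` and `2 * N`.
    have h1 : ((2 * N : ℕ) : ℤ) ∣ i + N + v := by
      have : (i : ℤ) + N + v = (i + (N + κ) * ((Fintype.card F ^ j : ℕ) : ℤ)) -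
          ((Fintype.card F : ℤ) ^ j * κ - v) - ((2 * N : ℕ) : ℤ) * r := by
        have hr' : ((Fintype.card F : ℤ)) ^ j = 2 * r + 1 := by exact_mod_cast hr
        push_cast
        rw [hr']
        ring
      rw [this]
      exact dvd_sub (dvd_sub hij hv) (Dvd.intro _ rfl)
    have h2 := abs_le.1 (le_refl |v|)
    push_cast at h1 hvδ
    have := Int.le_of_dvd (by omega) h1
    omega

/-- The elements of an interval around `0` whose centred remainders modulo `q` and modulo
`2 R + 1` are not close to the ends of the respective systems of remainders. -/
def IsGood (q p R l : ℕ) (a : ℤ) : Prop :=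
  ¬ (a.natAbs % q = p ∨ a.natAbs % q = p + 1 ∨
      (R ≤ a.natAbs + (l + 1) ∧ a.natAbs ≤ R + l + 2)) ∧ a.natAbs + 2 * l + 1 ≤ 2 * R

theorem IsGood.neg {q p R l : ℕ} {a : ℤ} (h : IsGood q p R l a) : IsGood q p R l (-a) := by
  simpa [IsGood] using h

theorem IsGood.ne_add {q p R l : ℕ} (hq : q = 2 * p + 1) {b : ℤ} (h : IsGood q p R l b) (k : ℤ) :
    b ≠ q * k + p := by
  rintro rfl
  obtain ⟨h, -⟩ := h
  push Not at h
  have hqz : (q : ℤ) = 2 * p + 1 := by exact_mod_cast hq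
  rcases le_or_gt 0 k with hk | hk
  · refine h.1 ?_
    have : ((q * k + p : ℤ).natAbs : ℤ) % q = p := by
      rw [Int.natAbs_of_nonneg (by positivity), add_comm, Int.add_mul_emod_self_left,
        Int.emod_eq_of_lt (by omega) (by omega)]
    exact_mod_cast this
  · refine h.2.1 ?_
    have hneg : (q * k + p : ℤ) ≤ 0 := by nlinarith
    have : ((q * k + p : ℤ).natAbs : ℤ) % q = p + 1 := by
      rw [Int.ofNat_natAbs_of_nonpos hneg,
        show -(q * k + p : ℤ) = (p + 1) + q * (-k - 1) by rw [hqz]; ring,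
        Int.add_mul_emod_self_left]
      rcases Nat.eq_zero_or_pos p with rfl | hp
      · exfalso
        have := h.2.1
        simp at hqz
        subst hq
        simp [Nat.mod_one] at h
      · exact Int.emod_eq_of_lt (by omega) (by omega)
    exact_mod_cast this

/-- Write `b = c + d * q ^ (h - j)` with `c` small; as `Q ^ 2 ≡ -1`, the term in `d` contributes
only `-d`. For `j = 0` the window around `R` is excluded to make `c` small enough; for `j > 0` the
residues `±p` modulo `q` are excluded to keep `c` off the extreme centred remainders. -/
theorem IsGood.exists_abs_le {q p R l h δ : ℕ} (hq : q = 2 * p + 1) (hR : q ^ h = 2 * R + 1)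
    (hlq : 2 * l + 3 ≤ q) (hδ : δ ≤ (l + 1) * q ^ h + R + 1) {a b : ℤ} (ha : IsGood q p R l a)
    (hb : IsGood q p R l b) {j : ℕ} (hj : j < h) : ∃ v : ℤ, ((q : ℤ) ^ h) ^ 2 + 1 ∣
      (q : ℤ) ^ j * (a + (q : ℤ) ^ h * b) - v ∧ 2 * |v| + 2 * δ ≤ ((q : ℤ) ^ h) ^ 2 + 1 := by
  have hRz : (q : ℤ) ^ h = 2 * R + 1 := by exact_mod_cast hR
  have hδz : (δ : ℤ) ≤ (l + 1) * (q : ℤ) ^ h + R + 1 := by exact_mod_cast hδ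
  have ha2 : |a| + 2 * l + 1 ≤ 2 * R := by
    have := ha.2
    rw [Int.abs_eq_natAbs]
    omega
  have hb2 : |b| + 2 * l + 1 ≤ 2 * R := by
    have := hb.2
    rw [Int.abs_eq_natAbs]
    omega
  obtain ⟨ha3, ha4⟩ := abs_le.1 (by linarith : |a| ≤ 2 * R - 2 * l - 1)
  obtain ⟨hb3, hb4⟩ := abs_le.1 (by linarith : |b| ≤ 2 * R - 2 * l - 1)
  rcases Nat.eq_zero_or_pos j with rfl | hj0
  · obtain ⟨c, d, hbc, hc1, hc2, hd1, hd2⟩ : ∃ c d : ℤ, b = c + d * (2 * R + 1) ∧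
        -((R : ℤ) - (l + 2)) ≤ c ∧ c ≤ (R : ℤ) - (l + 2) ∧ -1 ≤ d ∧ d ≤ 1 := by
      have h1 : ¬ (R ≤ b.natAbs + (l + 1) ∧ b.natAbs ≤ R + l + 2) := fun h' => hb.1 (.inr (.inr h'))
      rcases lt_or_ge (b.natAbs + (l + 1)) R with h2 | h2
      · exact ⟨b, 0, by ring, by omega, by omega, by omega, by omega⟩
      · rcases le_or_gt 0 b with h3 | h3
        · exact ⟨b - (2 * R + 1), 1, by ring, by omega, by omega, by omega, by omega⟩
        · exact ⟨b + (2 * R + 1), -1, by ring, by omega, by omega, by omega, by omega⟩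
    refine ⟨a - d + (q : ℤ) ^ h * c, ⟨d, ?_⟩, ?_⟩
    · rw [hbc, ← hRz]; ring
    · rw [hRz] at hδz ⊢
      have h1 : |a - d + (2 * R + 1) * c| ≤ 2 * R - 2 * l + (2 * R + 1) * (R - (l + 2)) := by
        rw [abs_le]
        constructor <;> nlinarith
      nlinarith
  · obtain ⟨r', hr'⟩ : ∃ r', q ^ (h - j) = q * r' := dvd_pow_self q (by omega)
    have hqodd : Odd q := ⟨p, hq⟩
    obtain ⟨ρ, hρ⟩ := hqodd.pow (n := h - j)
    obtain ⟨ρ', hρ'⟩ : Odd r' := Nat.Odd.of_mul_right (hr' ▸ hqodd.pow (n := h - j))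
    have hρp : (ρ : ℤ) = q * ρ' + p := by
      have h1 : q * r' = 2 * ρ + 1 := by rw [← hr', hρ]
      rw [hρ', hq] at h1
      have h2 : ρ = q * ρ' + p := by rw [hq]; linarith
      exact_mod_cast h2
    set u : ℤ := (q : ℤ) ^ j with hu
    set r : ℤ := (2 * ρ + 1 : ℤ) with hr
    set Q : ℤ := (q : ℤ) ^ h with hQ
    have hur : u * r = Q := by
      have : (q : ℤ) ^ (h - j) = r := by rw [hr]; exact_mod_cast hρ
      rw [← this, hu, hQ, ← pow_add]; congr 1; omega
    have hqu : (q : ℤ) ≤ u := by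
      rw [hu]
      exact le_self_pow₀ (by omega) (by omega)
    have hrq : r = q * (r' : ℤ) := by rw [hr]; exact_mod_cast hρ.symm.trans hr'
    have hr0 : 0 < r := by omega
    set d : ℤ := (b + ρ) / r with hd
    set c : ℤ := (b + ρ) % r - ρ with hc
    have hbc : b = c + d * r := by
      have := Int.emod_add_mul_ediv (b + ρ) r
      rw [hd, hc]; linarith
    have hc1 : -(ρ : ℤ) ≤ c := by have := Int.emod_nonneg (b + ρ) hr0.ne'; omega
    have hc2 : c ≤ ρ := by have := Int.emod_lt_of_pos (b + ρ) hr0; omega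
    -- Since `ρ ≡ p` modulo `q` and `q ∣ r`, an extreme remainder would force `b ≡ ±p`. The gain of
    -- one in `|c|` is worth `2 * u * Q` in `2 * |v|`.
    have hcne : c ≠ ρ := by
      intro h1
      refine hb.ne_add hq (d * r' + ρ') ?_
      rw [hbc, h1, hrq, hρp]; ring
    have hcne' : c ≠ -ρ := by
      intro h1
      refine hb.neg.ne_add hq (-d * r' + ρ') ?_
      rw [hbc, h1, hrq, hρp]; ring
    have hd1 : d ≤ u := by
      by_contra! hlt
      have : (u + 1) * r ≤ d * r := mul_le_mul_of_nonneg_right (by omega) hr0.le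
      nlinarith
    have hd2 : -u ≤ d := by
      by_contra! hlt
      have : d * r ≤ (-u - 1) * r := mul_le_mul_of_nonneg_right (by omega) hr0.le
      nlinarith
    refine ⟨u * a - d + u * Q * c, ⟨d, ?_⟩, ?_⟩
    · rw [hbc, ← hur]; ring
    · have hu0 : 0 ≤ u := by omega
      have hQ0 : 0 ≤ Q := by omega
      have huQ : 0 ≤ u * Q := mul_nonneg hu0 hQ0
      have hua1 : u * a ≤ u * (Q - 2 * l - 2) := mul_le_mul_of_nonneg_left (by omega) hu0
      have hua2 : u * -(Q - 2 * l - 2) ≤ u * a := mul_le_mul_of_nonneg_left (by omega) hu0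
      have huc1 : u * Q * c ≤ u * Q * (ρ - 1) := mul_le_mul_of_nonneg_left (by omega) huQ
      have huc2 : u * Q * -(ρ - 1) ≤ u * Q * c := mul_le_mul_of_nonneg_left (by omega) huQ
      have h1 : |u * a - d + u * Q * c| ≤ u * (Q - 2 * l - 2) + u + u * Q * (ρ - 1) := by
        rw [abs_le]
        constructor <;> linarith
      have h2 : u * Q * (2 * ρ + 1) = Q * Q := by rw [← hr, mul_right_comm, hur]
      have h3 : (q : ℤ) * Q ≤ u * Q := mul_le_mul_of_nonneg_right hqu hQ0
      have h4 : (2 * l + 3) * Q ≤ q * Q := mul_le_mul_of_nonneg_right (by omega) hQ0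
      have h5 : 0 ≤ u * l := mul_nonneg hu0 (by positivity)
      linarith

end Spectrum

/-! ### At least half of the integers are good. -/

section Counting

theorem card_filter_mod_eq {q p : ℕ} (hp : 1 ≤ p) (hq : q = 2 * p + 1) (y : ℕ) :
    ((Finset.range (y + 1)).filter fun a => a % q = p ∨ a % q = p + 1).card =
      (y + p + 1) / q + (y + p) / q := by
  induction y with
  | zero =>
    rw [Nat.div_eq_of_lt (by omega), Nat.div_eq_of_lt (by omega)]
    simp
    omega
  | succ y ih =>
    have h1 : (q ∣ y + 1 + p + 1) ↔ (y + 1) % q = p := by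
      rw [Nat.dvd_iff_mod_eq_zero, add_assoc, Nat.add_mod, Nat.mod_eq_of_lt (a := p + 1) (by omega)]
      have := Nat.mod_lt (y + 1) (by omega : q > 0)
      constructor
      · intro h
        rcases lt_or_ge ((y + 1) % q + (p + 1)) q with h2 | h2
        · rw [Nat.mod_eq_of_lt h2] at h; omega
        · rw [Nat.mod_eq_sub_mod h2, Nat.mod_eq_of_lt (by omega)] at h; omega
      · intro h
        rw [h, show p + (p + 1) = q by omega, Nat.mod_self]
    have h2 : (q ∣ y + p + 1) ↔ (y + 1) % q = p + 1 := by
      rw [Nat.dvd_iff_mod_eq_zero, show y + p + 1 = (y + 1) + p by omega, Nat.add_mod,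
        Nat.mod_eq_of_lt (a := p) (by omega)]
      have := Nat.mod_lt (y + 1) (by omega : q > 0)
      constructor
      · intro h
        rcases lt_or_ge ((y + 1) % q + p) q with h2 | h2
        · rw [Nat.mod_eq_of_lt h2] at h; omega
        · rw [Nat.mod_eq_sub_mod h2, Nat.mod_eq_of_lt (by omega)] at h; omega
      · intro h
        rw [h, show p + 1 + p = q by omega, Nat.mod_self]
    have e1 : (y + 1 + p + 1) / q = (y + p + 1) / q + if (y + 1) % q = p then 1 else 0 := by
      rw [show y + 1 + p + 1 = (y + p + 1) + 1 by ring, Nat.succ_div]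
      congr 1
      simp only [← h1, show y + 1 + p + 1 = y + p + 1 + 1 by ring]
    have e2 : (y + 1 + p) / q = (y + p) / q + if (y + 1) % q = p + 1 then 1 else 0 := by
      rw [show y + 1 + p = (y + p) + 1 by ring, Nat.succ_div]
      congr 1
      simp only [← h2]
    rw [Finset.range_add_one, Finset.filter_insert, e1, e2]
    split_ifs with h3 h4 h5 <;>
      first
        | (rw [Finset.card_insert_of_notMem (by simp), ih]; omega)
        | (rw [ih]; omega)

/-- The values excluded by `IsGood`, on the level of absolute values. -/
def badSet (q p R l y : ℕ) : Finset ℕ :=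
  (Finset.range (y + 1)).filter fun a =>
    a % q = p ∨ a % q = p + 1 ∨ (R ≤ a + (l + 1) ∧ a ≤ R + l + 2)

theorem two_mul_card_badSet_le_of_ge {q p R l k : ℕ} (hp : 3 ≤ p) (hq : q = 2 * p + 1)
    (hR : R = q * k + p) (hlq : 2 * l + 3 ≤ q) (hl : 1 ≤ l)
    (hpk : p ≤ k) {y : ℕ} (hy : R + l + 2 ≤ y) :
    2 * (badSet q p R l y).card ≤ y := by
  have hsub : badSet q p R l y ⊆
      -- `R` and `R + 1` have residues `p` and `p + 1` and also lie in the window, so they are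
      -- removed to avoid double counting.
      (((Finset.range (y + 1)).filter fun a => a % q = p ∨ a % q = p + 1) \ {R, R + 1}) ∪
        Finset.Icc (R - (l + 1)) (R + l + 2) := by
    intro a ha
    simp only [badSet, Finset.mem_filter, Finset.mem_range, Finset.mem_union, Finset.mem_sdiff,
      Finset.mem_insert, Finset.mem_singleton, Finset.mem_Icc] at ha ⊢
    by_cases h : a = R ∨ a = R + 1
    · right; omega
    · rcases ha.2 with h1 | h1 | h1
      · exact .inl ⟨⟨ha.1, .inl h1⟩, h⟩
      · exact .inl ⟨⟨ha.1, .inr h1⟩, h⟩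
      · right; omega
  have hRmod : R % q = p := by
    rw [hR, Nat.mul_add_mod, Nat.mod_eq_of_lt (by omega)]
  have hRmod' : (R + 1) % q = p + 1 := by
    rw [hR, add_assoc, Nat.mul_add_mod, Nat.mod_eq_of_lt (by omega)]
  have hcard := (Finset.card_le_card hsub).trans (Finset.card_union_le _ _)
  rw [Finset.card_sdiff_of_subset, card_filter_mod_eq (by omega) hq, Finset.card_pair (by omega),
    Nat.card_Icc] at hcard
  swap
  · intro a ha
    simp only [Finset.mem_insert, Finset.mem_singleton] at ha
    simp only [Finset.mem_filter, Finset.mem_range]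
    rcases ha with rfl | rfl
    · exact ⟨by omega, .inl hRmod⟩
    · exact ⟨by omega, .inr hRmod'⟩
  have hf1 := Nat.div_mul_le_self (y + p + 1) q
  have hf1' := Nat.lt_div_mul_add (a := y + p + 1) (b := q) (by omega)
  have hf2 := Nat.div_mul_le_self (y + p) q
  have hf12 : (y + p) / q ≤ (y + p + 1) / q := Nat.div_le_div_right (by omega)
  set f₁ := (y + p + 1) / q
  set f₂ := (y + p) / q
  have hk : k + 1 ≤ f₁ := by
    rw [Nat.le_div_iff_mul_le (by omega)]
    nlinarith
  have hk' : k + 1 ≤ f₂ := by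
    rw [Nat.le_div_iff_mul_le (by omega)]
    nlinarith
  have hQ : 4 * (2 * k + 1) + 3 * q ≤ 2 * R + 1 := by rw [hR, hq]; nlinarith
  suffices 2 * (f₁ + f₂ + 2 * l + 2) ≤ y by omega
  rcases Nat.lt_or_ge (k + 1) f₁ with h | h
  · have h5 : (q - 4) * 5 ≤ (q - 4) * f₁ := Nat.mul_le_mul_left _ (by omega)
    obtain ⟨z, hz⟩ : ∃ z, q = z + 4 := ⟨q - 4, by omega⟩
    rw [hz, Nat.add_sub_cancel] at h5
    rw [hz] at hf1 hf2
    rcases hf12.lt_or_eq with h6 | h6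
    · nlinarith
    · rw [h6] at hf2
      nlinarith
  · have : f₁ = k + 1 := by omega
    have : f₂ = k + 1 := by omega
    omega

theorem two_mul_card_badSet_le {q p R l k : ℕ} (hp : 3 ≤ p) (hq : q = 2 * p + 1)
    (hR : R = q * k + p) (hlq : 2 * l + 3 ≤ q) (hl : 1 ≤ l)
    (hpk : p ≤ k) (y : ℕ) :
    2 * (badSet q p R l y).card ≤ y := by
  rcases le_or_gt (R + l + 2) y with hy | hy
  · exact two_mul_card_badSet_le_of_ge hp hq hR hlq hl hpk hy
  rcases Nat.lt_or_ge (y + (l + 1)) R with hy' | hy'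
  · have hsub : badSet q p R l y ⊆
        (Finset.range (y + 1)).filter fun a => a % q = p ∨ a % q = p + 1 := by
      intro a ha
      simp only [badSet, Finset.mem_filter, Finset.mem_range] at ha ⊢
      refine ⟨ha.1, ?_⟩
      rcases ha.2 with h | h | h
      exacts [.inl h, .inr h, by omega]
    have hcard := Finset.card_le_card hsub
    rw [card_filter_mod_eq (by omega) hq] at hcard
    have hf1 := Nat.div_mul_le_self (y + p + 1) q
    have hf2 := Nat.div_mul_le_self (y + p) q
    have hf12 : (y + p) / q ≤ (y + p + 1) / q := Nat.div_le_div_right (by omega)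
    set f₁ := (y + p + 1) / q
    set f₂ := (y + p) / q
    suffices 2 * (f₁ + f₂) ≤ y by omega
    obtain ⟨z, hz⟩ : ∃ z, q = z + 4 := ⟨q - 4, by omega⟩
    rw [hz] at hf1 hf2
    rcases Nat.eq_zero_or_pos f₁ with h0 | h0
    · omega
    have : z * 1 ≤ z * f₁ := Nat.mul_le_mul_left _ h0
    rcases hf12.lt_or_eq with h6 | h6
    · nlinarith
    · rw [h6] at hf2
      nlinarith
  -- Inside the window every integer is bad, so the estimate at its right end implies the one at
  -- `y`.
  · have h1 := two_mul_card_badSet_le_of_ge hp hq hR hlq hl hpk (le_refl (R + l + 2))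
    have hsub : badSet q p R l y ∪ Finset.Ioc y (R + l + 2) ⊆ badSet q p R l (R + l + 2) := by
      intro a ha
      simp only [badSet, Finset.mem_union, Finset.mem_filter, Finset.mem_range,
        Finset.mem_Ioc] at ha ⊢
      rcases ha with ha | ha
      · exact ⟨by omega, ha.2⟩
      · exact ⟨by omega, .inr (.inr (by omega))⟩
    have hdisj : Disjoint (badSet q p R l y) (Finset.Ioc y (R + l + 2)) := by
      rw [Finset.disjoint_left]
      intro a ha ha'
      simp only [badSet, Finset.mem_filter, Finset.mem_range, Finset.mem_Ioc] at ha ha'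
      omega
    have h2 := Finset.card_le_card hsub
    rw [Finset.card_union_of_disjoint hdisj, Nat.card_Ioc] at h2
    omega

open Classical in
theorem lt_two_mul_card_filter_isGood {q p R l k w : ℕ} (hp : 3 ≤ p) (hq : q = 2 * p + 1)
    (hR : R = q * k + p) (hlq : 2 * l + 3 ≤ q) (hl : 1 ≤ l)
    (hpk : p ≤ k) (hw : 0 < w) (hwR : w + 4 * l + 1 ≤ 4 * R) :
    w < 2 * ((Finset.Ico ((w / 2 : ℕ) + 1 - w : ℤ) ((w / 2 : ℕ) + 1 - w + w)).filter
      (IsGood q p R l)).card := by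
  set x := w / 2
  set I := Finset.Ico ((x : ℤ) + 1 - w) ((x : ℤ) + 1 - w + w)
  have hI : I.card = w := by simp [I]
  have h := Finset.card_filter_add_card_filter_not (s := I) (IsGood q p R l)
  have hsub : I.filter (fun a => ¬ IsGood q p R l a) ⊆
      (badSet q p R l x).image (fun a : ℕ => (a : ℤ)) ∪
        -- The two halves reach up to `x` and `w - 1 - x`, so twice the number of bad elements is at
        -- most `w - 1`; this missing one gives the strict inequality.
        (badSet q p R l (w - 1 - x)).image (fun a : ℕ => -(a : ℤ)) := by
    intro a ha
    simp only [I, Finset.mem_filter, Finset.mem_Ico, IsGood, not_and_or, not_not] at ha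
    obtain ⟨ha1, ha2⟩ := ha
    have ha2 := ha2.resolve_right (by omega)
    simp only [Finset.mem_union, Finset.mem_image, badSet, Finset.mem_filter, Finset.mem_range]
    rcases le_or_gt 0 a with h0 | h0
    · exact .inl ⟨a.natAbs, ⟨by omega, ha2⟩, by omega⟩
    · exact .inr ⟨a.natAbs, ⟨by omega, ha2⟩, by omega⟩
  have h1 := (Finset.card_le_card hsub).trans ((Finset.card_union_le _ _).trans
    (add_le_add Finset.card_image_le Finset.card_image_le))
  have h2 := two_mul_card_badSet_le hp hq hR hlq hl hpk x
  have h3 := two_mul_card_badSet_le hp hq hR hlq hl hpk (w - 1 - x)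
  omega

end Counting

/-! ### Minimum distances of the BCH code and its dual. -/

section Distance

theorem hammingNorm_algebraMap {F K ι : Type*} [Field F] [Field K] [Algebra F K] [Fintype ι]
    [DecidableEq F] [DecidableEq K] (c : ι → F) :
    hammingNorm (fun t => algebraMap F K (c t)) = hammingNorm c :=
  hammingNorm_comp (fun _ => algebraMap F K) (fun _ => (algebraMap F K).injective)
    (fun _ => map_zero _)

/-- The BCH bound, as the case `B = {0}` of the two-set bound. -/
theorem lt_hammingNorm_of_mem_run {K : Type*} [Field K] [DecidableEq K] {n : ℕ} {β : K}
    (hβ : IsPrimitiveRoot β n) {c : Fin n → K} (hc : c ≠ 0) {k a₀ : ℤ} {r : ℕ}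
    (h : ∀ a, a₀ ≤ a → a < a₀ + r → ∑ t, c t * (β ^ (k + a)) ^ (t : ℕ) = 0) :
    r < hammingNorm c := by
  by_contra! hle
  have hpos := hammingNorm_pos_iff.2 hc
  have := card_add_card_le_hammingNorm hβ (c := c) (s := 1) isCoprime_one_left (k := k)
    (A := Finset.Ico a₀ (a₀ + hammingNorm c)) (B := {0}) (b₀ := 0) subset_rfl (by simpa) (by
      intro a ha b hb
      rw [Finset.mem_Ico] at ha
      rw [Finset.mem_singleton.1 hb, mul_zero, add_zero]
      exact h a ha.1 (by omega))
  simp at this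

variable {F K : Type*} [Field F] [Field K] [Algebra F K] [DecidableEq F]

theorem le_hammingNorm_of_mem_bchCode {n δ : ℕ} {β : K} (hβ : IsPrimitiveRoot β n)
    {c : Fin n → F} (hc : c ∈ bchCode F n β δ) (hc0 : c ≠ 0) : δ ≤ hammingNorm c := by
  classical
  rw [mem_bchCode_iff hβ.pow_eq_one] at hc
  rw [← hammingNorm_algebraMap (K := K)]
  have hc0' : (fun t => algebraMap F K (c t)) ≠ 0 := fun h =>
    hc0 (funext fun t => (algebraMap F K).injective (by simpa using congrFun h t))
  have := lt_hammingNorm_of_mem_run hβ hc0' (k := 0) (a₀ := 1) (r := δ - 1) (by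
    intro a ha1 ha2
    obtain ⟨i, rfl⟩ := Int.eq_ofNat_of_zero_le (by omega : 0 ≤ a)
    rw [zero_add, zpow_natCast]
    exact hc i (by omega) (by omega))
  omega

theorem le_hammingNorm_of_mem_euclideanDual_of_card [Fintype F] {q p l N δ : ℕ}
    (hcard : Fintype.card F = q) (hq : q = 2 * p + 1) (hlq : 2 * l + 3 ≤ q)
    (hN : 2 * N = q ^ 2 + 1) (hδ : δ ≤ (l + 1) * q + p + 1) {β : K}
    (hβ : IsPrimitiveRoot β (2 * N)) {x : Fin (2 * N) → F}
    (hx : x ∈ euclideanDual (bchCode F (2 * N) β δ)) (hx0 : x ≠ 0) :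
    q - 2 * l - 1 ≤ hammingNorm x := by
  classical
  rw [← hammingNorm_algebraMap (K := K)]
  have hx0' : (fun t => algebraMap F K (x t)) ≠ 0 := fun h =>
    hx0 (funext fun t => (algebraMap F K).injective (by simpa using congrFun h t))
  have hNz : ((2 * N : ℕ) : ℤ) = ((q : ℤ) ^ 1) ^ 2 + 1 := by rw [hN]; push_cast; ring
  have hpos : 0 < N := by omega
  have := lt_hammingNorm_of_mem_run hβ hx0' (k := N) (a₀ := -((p : ℤ) - (l + 1)))
    (r := q - 2 * l - 2) (by
    intro a ha1 ha2
    refine sum_eq_zero_of_abs_le hpos hβ (hcard ▸ ⟨p, hq⟩) (fun j => ?_) hx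
    rw [hNz, hcard]
    have := exists_abs_le_of_orbit (q := q) (h := 1) (δ := δ) one_pos
      -- Multiplication by `q` alternates between the axes `b = 0` and `a = 0`. The worst case `q *
      -- (p - l - 1)` meets the bound for `δ` with equality.
      (G := fun a b => |a| ≤ (p : ℤ) - (l + 1) ∧ |b| ≤ (p : ℤ) - (l + 1) ∧ (a = 0 ∨ b = 0))
      (fun a b h => ⟨by simpa using h.2.1, h.1, by simpa using h.2.2.symm⟩) ?_
      (a := a) (b := 0) ⟨abs_le.2 ⟨ha1, by omega⟩, by simp; omega, .inr rfl⟩ j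
    · simpa using this
    · rintro a b ⟨ha, hb, hab⟩ j hj
      obtain rfl : j = 0 := by omega
      refine ⟨a + q * b, by simp, ?_⟩
      have hqz : (q : ℤ) = 2 * p + 1 := by exact_mod_cast hq
      have hδz : (δ : ℤ) ≤ (l + 1) * q + p + 1 := by exact_mod_cast hδ
      have h1 : |a + q * b| ≤ q * ((p : ℤ) - (l + 1)) := by
        have hq1 : (1 : ℤ) ≤ q := by omega
        rcases hab with rfl | rfl
        · rw [zero_add, abs_mul, Nat.abs_cast]
          exact mul_le_mul_of_nonneg_left hb (by omega)
        · rw [mul_zero, add_zero]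
          nlinarith [abs_nonneg a]
      rw [hqz] at h1 hδz ⊢
      nlinarith)
  omega

theorem le_hammingNorm_of_mem_euclideanDual_of_card_pow [Fintype F] {q p l N δ h : ℕ}
    (hcard : Fintype.card F = q) (hq : q = 2 * p + 1) (hl : 2 ≤ l) (hlq : 2 * l + 3 ≤ q)
    (hh : 2 ≤ h) (hN : 2 * N = (q ^ h) ^ 2 + 1)
    (hδ : δ ≤ (l + 1) * q ^ h + (q ^ h - 1) / 2 + 1) {β : K}
    (hβ : IsPrimitiveRoot β (2 * N)) {x : Fin (2 * N) → F}
    (hx : x ∈ euclideanDual (bchCode F (2 * N) β δ)) (hx0 : x ≠ 0) :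
    2 * q ^ h - 4 * l - 2 ≤ hammingNorm x := by
  classical
  have hqodd : Odd q := ⟨p, hq⟩
  obtain ⟨R, hR⟩ := hqodd.pow (n := h)
  obtain ⟨k, hk⟩ := hqodd.pow (n := h - 1)
  have hqh : q ^ h = q * q ^ (h - 1) := by rw [← pow_succ']; congr 1; omega
  have hRk : R = q * k + p := by
    have h1 : 2 * R + 1 = q * (2 * k + 1) := by rw [← hR, ← hk, hqh]
    linarith
  have hpk : p ≤ k := by
    have : q ≤ q ^ (h - 1) := Nat.le_self_pow (by omega) q
    omega
  rw [show (q ^ h - 1) / 2 = R by omega] at hδ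
  rw [← hammingNorm_algebraMap (K := K)]
  set c : Fin (2 * N) → K := fun t => algebraMap F K (x t)
  have hc0 : c ≠ 0 := fun h =>
    hx0 (funext fun t => (algebraMap F K).injective (by simpa [c] using congrFun h t))
  have hNz : ((2 * N : ℕ) : ℤ) = ((q : ℤ) ^ h) ^ 2 + 1 := by rw [hN]; push_cast; ring
  have hpos : 0 < N := by omega
  by_contra! hlt
  have hcop : IsCoprime ((q : ℤ) ^ h) ((2 * N : ℕ) : ℤ) := by
    rw [hNz]
    exact ⟨-(q : ℤ) ^ h, 1, by ring⟩
  have key := card_add_card_le_hammingNorm hβ hcop (c := c) (k := N)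
    (a₀ := (hammingNorm c / 2 : ℕ) + 1 - hammingNorm c)
    (b₀ := (hammingNorm c / 2 : ℕ) + 1 - hammingNorm c)
    (Finset.filter_subset (IsGood q p R l) _) (Finset.filter_subset (IsGood q p R l) _) (by
      intro a ha b hb
      rw [add_assoc]
      refine sum_eq_zero_of_abs_le hpos hβ (hcard ▸ hqodd) (fun j => ?_) hx
      rw [hNz, hcard]
      exact exists_abs_le_of_orbit (by omega) (G := fun a b => IsGood q p R l a ∧ IsGood q p R l b)
        (fun a b h => ⟨h.2.neg, h.1⟩)
        (fun a b h j hj => h.1.exists_abs_le hq hR hlq hδ h.2 hj)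
        ⟨(Finset.mem_filter.1 ha).2, (Finset.mem_filter.1 hb).2⟩ j)
  have := lt_two_mul_card_filter_isGood (w := hammingNorm c) (by omega) hq hRk hlq (by omega) hpk
    (hammingNorm_pos_iff.2 hc0) (by omega)
  omega

end Distance

/-! ### Weights in the matrix-product code. -/

section MatrixProduct

variable {F ι : Type*} [Field F]

theorem le_minDist [Fintype ι] [DecidableEq F] {C : Submodule F (ι → F)} {d : ℕ} (hC : ∃ c ∈ C, c ≠ 0)
    (h : ∀ c ∈ C, c ≠ 0 → d ≤ hammingNorm c) : d ≤ minDist C := by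
  obtain ⟨c, hc, hc0⟩ := hC
  refine le_csInf ⟨_, c, hc, hc0, rfl⟩ ?_
  rintro w ⟨c, hc, hc0, rfl⟩
  exact (h c hc hc0).trans_eq (by congr!)

theorem mem_matrixProductCode_pair {C D : Submodule F (ι → F)} {A : Matrix (Fin 2) (Fin 2) F}
    {c : Fin 2 × ι → F} : c ∈ matrixProductCode ![C, D] A ↔
      ∃ u ∈ C, ∃ v ∈ D, c = fun p => A 0 p.1 * u p.2 + A 1 p.1 * v p.2 := by
  simp only [matrixProductCode, Submodule.mem_map, Submodule.mem_pi, Set.mem_univ, true_imp_iff,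
    Fin.forall_fin_two]
  constructor
  · rintro ⟨w, hw, rfl⟩
    exact ⟨w 0, hw.1, w 1, hw.2, funext fun p => by simp [matrixProductMap, Fin.sum_univ_two]⟩
  · rintro ⟨u, hu, v, hv, rfl⟩
    exact ⟨![u, v], ⟨hu, hv⟩, funext fun p => by simp [matrixProductMap, Fin.sum_univ_two]⟩

theorem hammingNorm_prod_fin_two [Fintype ι] [DecidableEq F] (c : Fin 2 × ι → F) :
    hammingNorm c = hammingNorm (fun t => c (0, t)) + hammingNorm (fun t => c (1, t)) := by
  classical
  simp only [hammingNorm, Finset.card_filter, Fintype.sum_prod_type, Fin.sum_univ_two]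

theorem hammingNorm_const_mul [Fintype ι] [DecidableEq F] {a : F} (ha : a ≠ 0) (u : ι → F) :
    hammingNorm (fun t => a * u t) = hammingNorm u :=
  hammingNorm_comp (fun _ x => a * x) (fun _ => mul_right_injective₀ ha) (fun _ => mul_zero a)

theorem hammingNorm_le_of_isUnit_det [Fintype ι] [DecidableEq F] {A : Matrix (Fin 2) (Fin 2) F}
    (hA : IsUnit A.det) (u v : ι → F) :
    hammingNorm v ≤ hammingNorm fun p : Fin 2 × ι => A 0 p.1 * u p.2 + A 1 p.1 * v p.2 := by
  classical
  rw [hammingNorm_prod_fin_two]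
  refine le_trans (Finset.card_le_card ?_) (Finset.card_union_le _ _)
  intro t ht
  simp only [Finset.mem_union, Finset.mem_filter, Finset.mem_univ, true_and] at ht ⊢
  by_contra! h
  have h1 : A.det * v t = 0 := by
    rw [Matrix.det_fin_two]
    linear_combination A 0 0 * h.2 - A 0 1 * h.1
  exact ht ((mul_eq_zero.1 h1).resolve_left hA.ne_zero)

end MatrixProduct

theorem sqrt_two_mul_lt {q h l : ℕ} (hq : 7 ≤ q) (hlq : 2 * l + 3 ≤ q) (hh : 2 ≤ h) :
    Real.sqrt (2 * ((q ^ h) ^ 2 + 1 : ℕ)) < 2 * (q : ℝ) ^ h - 4 * l - 2 := by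
  have h1 : (q : ℝ) ^ 2 ≤ (q : ℝ) ^ h := pow_le_pow_right₀ (by norm_cast; omega) hh
  have h2 : (7 : ℝ) ≤ q := by exact_mod_cast hq
  have h3 : 2 * (l : ℝ) + 3 ≤ q := by exact_mod_cast hlq
  have h4 : 7 * (q : ℝ) ≤ (q : ℝ) ^ h := by nlinarith
  push_cast
  set Q := (q : ℝ) ^ h
  rw [Real.sqrt_lt' (by linarith)]
  -- Here `4 * l + 2 ≤ 2 * q - 4` and `7 * q ≤ Q`.
  have h5 : 3 / 2 * Q ≤ 2 * Q - 4 * l - 2 := by linarith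
  have h6 : (3 / 2 * Q) ^ 2 ≤ (2 * Q - 4 * l - 2) ^ 2 := pow_le_pow_left₀ (by linarith) h5 2
  nlinarith

theorem mainTheorem8 {F K : Type*} [Field F] [Fintype F] [Field K] [Algebra F K]
    (q m n l δ : ℕ) (hq : Fintype.card F = q) (hqodd : Odd q)
    (hm : Even m) (hmpos : 0 < m) (hn : n = q ^ m + 1)
    (β : K) (hβ : IsPrimitiveRoot β n)
    (hl : 2 ≤ l) (hl' : l ≤ (q - 3) / 2)
    (hδ : l * q ^ (m / 2) + (q ^ (m / 2) + 3) / 2 ≤ δ)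
    (hδ' : δ < (l + 1) * q ^ (m / 2) + (q ^ (m / 2) + 3) / 2)
    (A : Matrix (Fin 2) (Fin 2) F) (hA : IsUnit A.det)
    (hA₂ : m = 2 → A 0 0 ≠ 0 ∧ A 0 1 ≠ 0) :
    2 * (q : ℝ) ^ (m / 2) - 4 * l - 2 ≤
        (minDist (matrixProductCode ![euclideanDual (bchCode F n β δ), bchCode F n β δ] A) : ℝ) ∧
      (4 ≤ m → Real.sqrt (2 * n) < 2 * (q : ℝ) ^ (m / 2) - 4 * l - 2) := by
  classical
  obtain ⟨p, hp⟩ := hqodd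
  obtain ⟨h, rfl⟩ := hm
  rw [← two_mul] at *
  rw [Nat.mul_div_cancel_left h two_pos] at *
  have hlq : 2 * l + 3 ≤ q := by omega
  have hnQ : n = (q ^ h) ^ 2 + 1 := by rw [hn, ← pow_mul, mul_comm]
  have hQodd : Odd (q ^ h) := Odd.pow ⟨p, hp⟩
  obtain ⟨R, hR⟩ := hQodd
  obtain ⟨N, rfl⟩ : ∃ N, n = 2 * N :=
    ⟨2 * R ^ 2 + 2 * R + 1, by rw [hnQ, hR]; ring⟩
  refine ⟨?_, fun hm4 => by rw [hnQ]; exact sqrt_two_mul_lt (by omega) hlq (by omega)⟩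
  have hδR : δ ≤ (l + 1) * q ^ h + R + 1 := by omega
  have hδ2 : 2 * q ^ h ≤ δ := by
    have : 2 * q ^ h ≤ l * q ^ h := Nat.mul_le_mul_right _ hl
    omega
  have hdual : ∀ u ∈ euclideanDual (bchCode F (2 * N) β δ), u ≠ 0 →
      2 * q ^ h - 4 * l - 2 ≤ hammingNorm (fun t => A 0 0 * u t) +
        hammingNorm (fun t => A 0 1 * u t) := by
    intro u hu hu0
    rcases (by omega : h = 1 ∨ 2 ≤ h) with rfl | hh
    · obtain ⟨h00, h01⟩ := hA₂ rfl
      rw [hammingNorm_const_mul h00, hammingNorm_const_mul h01]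
      rw [pow_one] at hnQ hδR hR ⊢
      have := le_hammingNorm_of_mem_euclideanDual_of_card hq hp hlq hnQ
        (by rwa [show p = R by omega]) hβ hu hu0
      omega
    · have hw := le_hammingNorm_of_mem_euclideanDual_of_card_pow hq hp hl hlq hh hnQ
        (by rwa [show (q ^ h - 1) / 2 = R by omega]) hβ hu hu0
      by_cases h00 : A 0 0 = 0
      · have h01 : A 0 1 ≠ 0 := fun h01 => hA.ne_zero (by simp [Matrix.det_fin_two, h00, h01])
        rw [hammingNorm_const_mul h01]
        omega
      · rw [hammingNorm_const_mul h00]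
        omega
  have hmain : 2 * q ^ h - 4 * l - 2 ≤ minDist (matrixProductCode
      ![euclideanDual (bchCode F (2 * N) β δ), bchCode F (2 * N) β δ] A) := by
    have hbound : ∀ u ∈ euclideanDual (bchCode F (2 * N) β δ), ∀ v ∈ bchCode F (2 * N) β δ,
        u ≠ 0 ∨ v ≠ 0 → 2 * q ^ h - 4 * l - 2 ≤
          hammingNorm fun p : Fin 2 × Fin (2 * N) => A 0 p.1 * u p.2 + A 1 p.1 * v p.2 := by
      intro u hu v hv huv
      by_cases hv0 : v = 0
      · have := hdual u hu (huv.resolve_right (not_not.2 hv0))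
        rw [hammingNorm_prod_fin_two]
        simpa [hv0] using this
      · have h1 := le_hammingNorm_of_mem_bchCode hβ hv hv0
        have h2 := hammingNorm_le_of_isUnit_det hA u v
        omega
    have hQpos : 0 < 2 * q ^ h - 4 * l - 2 := by
      have : q ≤ q ^ h := Nat.le_self_pow (by omega) q
      omega
    refine le_minDist ?_ ?_
    -- `minDist` is `0` on the zero code, so a nonzero word is required; if the BCH code is zero,
    -- the all-ones word lies in its dual.
    · obtain ⟨u, hu, v, hv, huv⟩ : ∃ u ∈ euclideanDual (bchCode F (2 * N) β δ),
          ∃ v ∈ bchCode F (2 * N) β δ, u ≠ 0 ∨ v ≠ 0 := by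
        by_cases hC : ∃ v ∈ bchCode F (2 * N) β δ, v ≠ 0
        · obtain ⟨v, hv, hv0⟩ := hC
          exact ⟨0, zero_mem _, v, hv, .inr hv0⟩
        · push Not at hC
          refine ⟨fun _ => 1, fun c hc => by simp [hC c hc], 0, zero_mem _, .inl fun h1 => ?_⟩
          exact one_ne_zero (congrFun h1 ⟨0, by omega⟩)
      refine ⟨_, mem_matrixProductCode_pair.2 ⟨u, hu, v, hv, rfl⟩, ?_⟩
      rw [← hammingNorm_pos_iff]
      exact hQpos.trans_le (hbound u hu v hv huv)
    · intro c hc hc0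
      obtain ⟨u, hu, v, hv, rfl⟩ := mem_matrixProductCode_pair.1 hc
      refine hbound u hu v hv ?_
      by_contra! h0
      exact hc0 (funext fun p => by simp [h0.1, h0.2])
  have hle : 4 * l + 2 ≤ 2 * q ^ h := by
    have : q ≤ q ^ h := Nat.le_self_pow (by omega) q
    omega
  have hcast : (2 * (q : ℝ) ^ h - 4 * l - 2) = ((2 * q ^ h - 4 * l - 2 : ℕ) : ℝ) := by
    rw [Nat.sub_sub, Nat.cast_sub hle]
    push_cast
    ring
  rw [hcast]
  exact_mod_cast hmain
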